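/- Let $d\ge 0$ be an integer and fix $\phi\in C^\infty(\mathbb{R}^d)$, non-negative, supported in the closed unit ball, constant on $\{|x|\le 1/2\}$, with $\int\phi=1$; put $\phi_\epsilon(x)=\epsilon^{-d}\phi(\epsilon^{-1}x)$. For a tempered distribution $T$ on $\mathbb{R}^d$ let $$M_\phi(T)(x)=\sup_{\epsilon>0}|(T*\phi_\epsilon)(x)|\in[0,\infty],\qquad \Psi(x,t)=\frac{t}{\log(e+t)+\log(e+|x|)}\quad(t\ge 0),\qquad \Psi(x,\infty)=\infty.$$ Let $H^{\log}(\mathbb{R}^d)$ be the set of tempered distributions $T$ with $\int_{\mathbb{R}^d}\Psi(x,M_\phi(T)(x))\,dx<\infty$. For $B\subseteq\mathbb{R}^d$ measurable, let $L\log\log L(B)$ be the set of locally integrable $f$ on $\mathbb{R}^d$ with $\mathrm{supp}(f)\subseteq B$ and $\int_B|f|\log^+\log^+|f|\,dx<\infty$, where $\log^+ s=\max\{\log s,0\}$ for $s>0$ and $\log^+0=0$. Let $U\subseteq\mathbb{R}^d$ be open and let $T\in H^{\log}(\mathbb{R}^d)$ be given on $U$ by a function $f$, that is, $f$ is locally integrable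 on $U$ and $\langle T,\psi\rangle=\int_U f\psi\,dx$ for all $\psi\in C_c^\infty(U)$ (for instance, $T$ may be given by a locally integrable function $f$ on all of $\mathbb{R}^d$). If $f\ge 0$ almost everywhere on $U$, then for every compact set $K\subset U$ the restriction $f\mathbf{1}_K$ belongs to $L\log\log L(K)$; in particular $$\int_K |f|\,\log^+\log^+|f|\,dx<\infty .$$ -/

import Mathlib

open MeasureTheory Real
open scoped ENNReal SchwartzMap ContDiff

namespace HLogSpace

/-- The fixed smooth kernels `φ` on `ℝ^d`: non-negative, `C^∞`, supported in the unit ball,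
of integral one, and constant on the ball of radius `1/2`. -/
structure Kernel (d : ℕ) where
  toFun : EuclideanSpace ℝ (Fin d) → ℝ
  smooth : ContDiff ℝ ∞ toFun
  nonneg : ∀ x, 0 ≤ toFun x
  support_subset : Function.support toFun ⊆ Metric.closedBall 0 1
  integral_eq_one : ∫ x, toFun x = 1
  const_near_zero : ∃ c₀ : ℝ, ∀ x, ‖x‖ ≤ 1 / 2 → toFun x = c₀

variable {d : ℕ}

/-- `φ_ε(x) = ε^{-d} φ(ε^{-1} x)`. -/
noncomputable def Kernel.dilate (φ : Kernel d) (ε : ℝ) (x : EuclideanSpace ℝ (Fin d)) : ℝ :=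
  (ε ^ d)⁻¹ * φ.toFun (ε⁻¹ • x)

theorem Kernel.contDiff_reflect (φ : Kernel d) (ε : ℝ) (x : EuclideanSpace ℝ (Fin d)) :
    ContDiff ℝ ∞ (fun y => ((φ.dilate ε (x - y) : ℝ) : ℂ)) := by
  have h : ContDiff ℝ ∞ (fun y => φ.dilate ε (x - y)) :=
    contDiff_const.mul (φ.smooth.comp ((contDiff_const.sub contDiff_id).const_smul ε⁻¹))
  exact Complex.ofRealCLM.contDiff.comp h

theorem Kernel.hasCompactSupport_reflect (φ : Kernel d) {ε : ℝ} (hε : 0 < ε)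
    (x : EuclideanSpace ℝ (Fin d)) :
    HasCompactSupport (fun y => ((φ.dilate ε (x - y) : ℝ) : ℂ)) := by
  refine HasCompactSupport.intro (isCompact_closedBall x ε) fun y hy => ?_
  have h0 : φ.toFun (ε⁻¹ • (x - y)) = 0 := by
    by_contra hne
    have h1 := φ.support_subset (Function.mem_support.2 hne)
    rw [mem_closedBall_zero_iff, norm_smul, norm_inv, Real.norm_of_nonneg hε.le,
      inv_mul_le_iff₀ hε, mul_one] at h1
    exact hy (by rwa [Metric.mem_closedBall, dist_comm, dist_eq_norm])
  simp [Kernel.dilate, h0]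

/-- The Schwartz function `y ↦ φ_ε(x - y)`. -/
noncomputable def Kernel.reflect (φ : Kernel d) (ε : ℝ) (hε : 0 < ε)
    (x : EuclideanSpace ℝ (Fin d)) : 𝓢(EuclideanSpace ℝ (Fin d), ℂ) :=
  (φ.hasCompactSupport_reflect hε x).toSchwartzMap (φ.contDiff_reflect ε x)

/-- The convolution `(T ∗ φ_ε)(x) = ⟨T, φ_ε(x - ·)⟩` of a tempered distribution with `φ_ε`. -/
noncomputable def conv (φ : Kernel d) (T : 𝓢'(EuclideanSpace ℝ (Fin d), ℂ)) (ε : ℝ) (hε : 0 < ε)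
    (x : EuclideanSpace ℝ (Fin d)) : ℂ :=
  T (φ.reflect ε hε x)

/-- The maximal function `M_φ(T)(x) = sup_{ε > 0} |(T ∗ φ_ε)(x)|`, with values in `[0, ∞]`. -/
noncomputable def maximalFunction (φ : Kernel d) (T : 𝓢'(EuclideanSpace ℝ (Fin d), ℂ))
    (x : EuclideanSpace ℝ (Fin d)) : ℝ≥0∞ :=
  ⨆ (ε : ℝ) (hε : 0 < ε), ‖conv φ T ε hε x‖ₑ

/-- `Ψ(x, t) = t / (log (e + t) + log (e + |x|))`, used for `t ≥ 0`. -/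
noncomputable def Psi (x : EuclideanSpace ℝ (Fin d)) (t : ℝ) : ℝ :=
  t / (Real.log (Real.exp 1 + t) + Real.log (Real.exp 1 + ‖x‖))

/-- `H^log(ℝ^d)`: the tempered distributions `T` with `∫ Ψ(x, M_φ(T)(x)) dx < ∞`. Since
`Ψ(x, t) → ∞` as `t → ∞`, this includes that `M_φ(T)` is finite almost everywhere. -/
def HLog (φ : Kernel d) : Set (𝓢'(EuclideanSpace ℝ (Fin d), ℂ)) :=
  {T | (∀ᵐ x, maximalFunction φ T x < ⊤) ∧
    ∫⁻ x, ENNReal.ofReal (Psi x (maximalFunction φ T x).toReal) < ⊤}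

/-- `L log log L (B)`: the locally integrable functions `f` on `ℝ^d` with `supp f ⊆ B` and
`∫_B |f| log⁺ log⁺ |f| < ∞`. -/
def LLogLog (B : Set (EuclideanSpace ℝ (Fin d))) : Set (EuclideanSpace ℝ (Fin d) → ℂ) :=
  {f | LocallyIntegrable f ∧ tsupport f ⊆ B ∧
    ∫⁻ x in B, ENNReal.ofReal (‖f x‖ * log⁺ (log⁺ ‖f x‖)) < ⊤}

/-- The tempered distribution `T` is given on the open set `U` by the function `f`: `f` is locally
integrable on `U`, and `⟨T, ψ⟩ = ∫_U f ψ` for all test functions `ψ ∈ C_c^∞(U)`. -/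
def IsFunctionOn (T : 𝓢'(EuclideanSpace ℝ (Fin d), ℂ)) (f : EuclideanSpace ℝ (Fin d) → ℂ)
    (U : Set (EuclideanSpace ℝ (Fin d))) : Prop :=
  LocallyIntegrableOn f U ∧
    ∀ ψ : 𝓢(EuclideanSpace ℝ (Fin d), ℂ), HasCompactSupport ψ → tsupport ψ ⊆ U →
      T ψ = ∫ x in U, f x * ψ x

end HLogSpace

namespace HLogSpace

/-! Write F = f 𝟙_K. The core is a reverse weak-type inequality (`exists_reverse_weak_type`): for
large l, the integral of |F| over {|F| > l} is at most C l |E_l|, where E_l is a bounded set on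
which M_φ(T) ≥ c₁ l. Positivity enters here: without cancellation, a ball on which F has mean at
least l forces M_φ(T) ≥ c₁ l on a translated ball of the same radius. Almost every point of {|F| >
l} is the centre of such a ball; with radii almost maximal, means over larger concentric balls are
at most l, and a Vitali selection gives the inequality. Large l makes the radii small, so T is
tested only inside U.

The levels l = 2^n are then summed (`lintegral_posLog_posLog_lt_top`). Up to an additive constant,
log⁺ log⁺ t is at most the sum of 1/(n+1) over large n with 2^n < t. By Tonelli it remains to
integrate the sum of 2^n/(n+1) over those n with x ∈ E_n. This sum is controlled by its last term,
and 2^N/(N+1) is at most a constant times Ψ(x, c₁ 2^N) for bounded x, hence at most a constant times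
Ψ(x, M_φ(T)(x)). -/

variable {d : ℕ}

/-! ### Differentiation and Vitali covering -/

/-- Almost every point of a superlevel set of an integrable function is the centre of a ball on
which the function has a large mean. -/
theorem ae_exists_mul_volume_closedBall_le {g : EuclideanSpace ℝ (Fin d) → ℝ≥0∞}
    (hg : AEMeasurable g) (hfin : ∫⁻ x, g x ≠ ⊤) (l : ℝ≥0∞) :
    ∀ᵐ x, l < g x → ∃ r > 0,
      l * volume (Metric.closedBall x r) ≤ ∫⁻ y in Metric.closedBall x r, g y := by
  filter_upwards [(Besicovitch.vitaliFamily
    (volume : Measure (EuclideanSpace ℝ (Fin d)))).ae_tendsto_lintegral_div hg hfin] with x hx hl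
  have h1 := (hx.comp (Besicovitch.tendsto_filterAt volume x)).eventually (lt_mem_nhds hl)
  obtain ⟨r, hr, hr0⟩ := (h1.and self_mem_nhdsWithin).exists
  have hr0 : 0 < r := hr0
  refine ⟨r, hr0, ?_⟩
  have h2 := (Metric.measure_closedBall_pos volume x hr0).ne'
  have h3 : volume (Metric.closedBall x r) ≠ ⊤ := measure_closedBall_lt_top.ne
  exact (ENNReal.le_div_iff_mul_le (Or.inl h2) (Or.inl h3)).1 (le_of_lt hr)

/-- If some ball about `x` has mean at least `l`, there is an almost largest one. -/
theorem exists_almost_maximal_radius {g : EuclideanSpace ℝ (Fin d) → ℝ≥0∞} {l : ℝ≥0∞} {ρ : ℝ}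
    (h : ∫⁻ x, g x < l * volume (Metric.closedBall (0 : EuclideanSpace ℝ (Fin d)) ρ))
    {x : EuclideanSpace ℝ (Fin d)}
    (hx : ∃ r > 0, l * volume (Metric.closedBall x r) ≤ ∫⁻ y in Metric.closedBall x r, g y) :
    ∃ r > 0, r < ρ ∧ l * volume (Metric.closedBall x r) ≤ ∫⁻ y in Metric.closedBall x r, g y ∧
      ∀ R, 2 * r ≤ R →
        ∫⁻ y in Metric.closedBall x R, g y ≤ l * volume (Metric.closedBall x R) := by
  set S : Set ℝ := {r | 0 < r ∧
    l * volume (Metric.closedBall x r) ≤ ∫⁻ y in Metric.closedBall x r, g y} with hS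
  have hlt : ∀ r ∈ S, r < ρ := by
    rintro r ⟨-, hr⟩
    by_contra! hle
    have h1 : volume (Metric.closedBall (0 : EuclideanSpace ℝ (Fin d)) ρ)
        ≤ volume (Metric.closedBall x r) := by
      rw [← Measure.addHaar_closedBall_center volume x ρ]
      exact measure_mono (Metric.closedBall_subset_closedBall hle)
    have h2 : l * volume (Metric.closedBall (0 : EuclideanSpace ℝ (Fin d)) ρ) ≤ ∫⁻ x, g x :=
      (mul_le_mul_right h1 l).trans (hr.trans (setLIntegral_le_lintegral _ _))
    exact absurd h (not_lt.2 h2)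
  obtain ⟨r₁, hr₁⟩ : S.Nonempty := by
    obtain ⟨r, h0, hr⟩ := hx
    exact ⟨r, h0, hr⟩
  have hbdd : BddAbove S := ⟨ρ, fun r hr => (hlt r hr).le⟩
  have hpos : 0 < sSup S := lt_of_lt_of_le hr₁.1 (le_csSup hbdd hr₁)
  -- The supremum need not be attained; a radius above half of it suffices, since then no radius
  -- from 2r on lies in `S`.
  obtain ⟨r, hr, hlr⟩ := exists_lt_of_lt_csSup ⟨r₁, hr₁⟩ (half_lt_self hpos)
  refine ⟨r, hr.1, hlt r hr, hr.2, fun R hR => ?_⟩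
  by_contra! hc
  have : R ∈ S := ⟨by linarith [hr.1], hc.le⟩
  linarith [le_csSup hbdd this]

/-- A reverse weak-type covering: a superlevel set `{g > l}` carries at most `l` times the measure
of the fivefold dilates of disjoint dilated balls centred in it, on which `g` has mean at least
`l`. -/
theorem exists_disjoint_closedBall_lintegral_le {g : EuclideanSpace ℝ (Fin d) → ℝ≥0∞}
    (hg : AEMeasurable g) {l : ℝ≥0∞} {ρ : ℝ}
    (h : ∫⁻ x, g x < l * volume (Metric.closedBall (0 : EuclideanSpace ℝ (Fin d)) ρ))
    {A : ℝ} (hA : 1 ≤ A) :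
    ∃ (u : Set (EuclideanSpace ℝ (Fin d))) (r : EuclideanSpace ℝ (Fin d) → ℝ), u.Countable ∧
      (∀ x ∈ u, l < g x ∧ 0 < r x ∧ r x < ρ ∧
        l * volume (Metric.closedBall x (r x)) ≤ ∫⁻ y in Metric.closedBall x (r x), g y) ∧
      (u.PairwiseDisjoint fun x => Metric.closedBall x (A * r x)) ∧
      ∫⁻ y in {y | l < g y}, g y ≤
        l * ∑' x : u, volume (Metric.closedBall (x : EuclideanSpace ℝ (Fin d)) (5 * (A * r x))) := by
  have hae := ae_exists_mul_volume_closedBall_le hg (ne_top_of_lt h) l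
  set P : Set (EuclideanSpace ℝ (Fin d)) := {x | l < g x ∧ ∃ r > 0,
      l * volume (Metric.closedBall x r) ≤ ∫⁻ y in Metric.closedBall x r, g y} with hP
  have hex : ∀ x : EuclideanSpace ℝ (Fin d), ∃ r : ℝ, x ∈ P → 0 < r ∧ r < ρ ∧
      l * volume (Metric.closedBall x r) ≤ ∫⁻ y in Metric.closedBall x r, g y ∧
      ∀ R, 2 * r ≤ R →
        ∫⁻ y in Metric.closedBall x R, g y ≤ l * volume (Metric.closedBall x R) := by
    intro x
    by_cases hx : x ∈ P
    · obtain ⟨r, h1, h2⟩ := exists_almost_maximal_radius h hx.2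
      exact ⟨r, fun _ => ⟨h1, h2⟩⟩
    · exact ⟨0, fun h => absurd h hx⟩
  choose r hr using hex
  obtain ⟨u, huP, hdisj, hcov⟩ := Vitali.exists_disjoint_subfamily_covering_enlargement_closedBall
    P id (fun x => A * r x) (A * ρ)
    (fun x hx => mul_le_mul_of_nonneg_left (hr x hx).2.1.le (by linarith)) 5 (by norm_num)
  have hcount : u.Countable := hdisj.countable_of_nonempty_interior fun x hx =>
    (Metric.nonempty_ball.2 (mul_pos (by linarith) (hr x (huP hx)).1)).mono
      Metric.ball_subset_interior_closedBall
  refine ⟨u, r, hcount, fun x hx => ⟨(huP hx).1, (hr x (huP hx)).1, (hr x (huP hx)).2.1,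
    (hr x (huP hx)).2.2.1⟩, hdisj, ?_⟩
  have := hcount.to_subtype
  calc ∫⁻ y in {y | l < g y}, g y
      ≤ ∫⁻ y in ⋃ x : u, Metric.closedBall (x : EuclideanSpace ℝ (Fin d)) (5 * (A * r x)), g y := by
        refine lintegral_mono_set' ?_
        filter_upwards [hae] with x hx hxl
        have hxP : x ∈ P := ⟨hxl, hx hxl⟩
        obtain ⟨b, hb, hsub⟩ := hcov x hxP
        refine Set.mem_iUnion.2 ⟨⟨b, hb⟩, hsub (Metric.mem_closedBall_self ?_)⟩
        exact mul_nonneg (by linarith) (hr x hxP).1.le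
    _ ≤ ∑' x : u, ∫⁻ y in Metric.closedBall (x : EuclideanSpace ℝ (Fin d)) (5 * (A * r x)), g y :=
        lintegral_iUnion_le _ _
    _ ≤ ∑' x : u, l * volume (Metric.closedBall (x : EuclideanSpace ℝ (Fin d)) (5 * (A * r x))) := by
        refine ENNReal.tsum_le_tsum fun x => ?_
        have hx := hr x (huP x.2)
        -- Since A ≥ 1, the enlarged radius 5Ar is at least 2r, so almost-maximality bounds the mean
        -- by l.
        exact hx.2.2.2 _ (by nlinarith [hx.1])
    _ = _ := ENNReal.tsum_mul_left

/-! ### Lower bounds for the maximal function -/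

/-- Continuity at a point where φ > 0. The centre cannot be taken to be 0, because the constant
value of φ near 0 may vanish; this is why translated balls appear below. -/
theorem Kernel.exists_le_on_closedBall (φ : Kernel d) :
    ∃ (a : EuclideanSpace ℝ (Fin d)) (r c : ℝ), 0 < r ∧ 0 < c ∧
      ∀ x ∈ Metric.closedBall a r, c ≤ φ.toFun x := by
  obtain ⟨a, ha⟩ : ∃ a, 0 < φ.toFun a := by
    by_contra! h
    have h0 : φ.toFun = fun _ => 0 := funext fun x => le_antisymm (h x) (φ.nonneg x)
    have := φ.integral_eq_one
    simp [h0] at this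
  have h1 : ∀ᶠ x in nhds a, φ.toFun a / 2 < φ.toFun x :=
    φ.smooth.continuous.continuousAt.eventually (lt_mem_nhds (half_lt_self ha))
  obtain ⟨r, hr, hsub⟩ := Metric.nhds_basis_closedBall.mem_iff.1 h1
  exact ⟨a, r, φ.toFun a / 2, hr, half_pos ha, fun x hx => (hsub hx).le⟩

/-- Convolving a non-negative function given on `U` with a kernel supported near `z`. -/
theorem enorm_conv_eq (φ : Kernel d) {T : 𝓢'(EuclideanSpace ℝ (Fin d), ℂ)}
    {U : Set (EuclideanSpace ℝ (Fin d))} (hU : MeasurableSet U)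
    {f : EuclideanSpace ℝ (Fin d) → ℂ} (hf : IsFunctionOn T f U)
    (hpos : ∀ᵐ x ∂(volume.restrict U), 0 ≤ (f x).re ∧ (f x).im = 0)
    {ε : ℝ} (hε : 0 < ε) {z : EuclideanSpace ℝ (Fin d)} (hz : Metric.closedBall z ε ⊆ U) :
    ‖conv φ T ε hε z‖ₑ = ∫⁻ y in U, ‖f y‖ₑ * ENNReal.ofReal (φ.dilate ε (z - y)) := by
  have hd0 : ∀ y, 0 ≤ φ.dilate ε (z - y) := fun y =>
    mul_nonneg (by positivity) (φ.nonneg _)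
  have hcoe : ∀ y, φ.reflect ε hε z y = ((φ.dilate ε (z - y) : ℝ) : ℂ) := fun y => rfl
  have hzero : ∀ y ∉ Metric.closedBall z ε, φ.dilate ε (z - y) = 0 := by
    intro y hy
    have h0 : φ.toFun (ε⁻¹ • (z - y)) = 0 := by
      by_contra hne
      have h1 := φ.support_subset (Function.mem_support.2 hne)
      rw [mem_closedBall_zero_iff, norm_smul, norm_inv, Real.norm_of_nonneg hε.le,
        inv_mul_le_iff₀ hε, mul_one] at h1
      exact hy (by rwa [Metric.mem_closedBall, dist_comm, dist_eq_norm])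
    simp [Kernel.dilate, h0]
  have hsupp : tsupport (φ.reflect ε hε z) ⊆ Metric.closedBall z ε := by
    refine closure_minimal (fun y hy => ?_) Metric.isClosed_closedBall
    by_contra hy'
    exact hy (by rw [hcoe, hzero y hy', Complex.ofReal_zero])
  have hcs : HasCompactSupport (φ.reflect ε hε z) := φ.hasCompactSupport_reflect hε z
  have heq : ∀ᵐ y ∂(volume.restrict U),
      f y * φ.reflect ε hε z y = ((‖f y‖ * φ.dilate ε (z - y) : ℝ) : ℂ) := by
    filter_upwards [hpos] with y hy
    have : f y = ((‖f y‖ : ℝ) : ℂ) := by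
      have h2 : f y = ((f y).re : ℂ) := Complex.ext rfl (by simp [hy.2])
      rw [h2, Complex.norm_of_nonneg hy.1]
    rw [hcoe, Complex.ofReal_mul, ← this]
  have hmeas : AEStronglyMeasurable (fun y => ‖f y‖ * φ.dilate ε (z - y))
      (volume.restrict U) := by
    refine hf.1.aestronglyMeasurable.norm.mul ?_
    have : Continuous fun y => φ.dilate ε (z - y) := by
      have := φ.smooth.continuous
      unfold Kernel.dilate
      fun_prop
    exact this.aestronglyMeasurable
  have hint : Integrable (fun y => ‖f y‖ * φ.dilate ε (z - y)) (volume.restrict U) := by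
    have hfB : IntegrableOn f (Metric.closedBall z ε) :=
      hf.1.integrableOn_compact_subset hz (isCompact_closedBall z ε)
    have hc : ContinuousOn (fun y => φ.dilate ε (z - y)) (Metric.closedBall z ε) := by
      have := φ.smooth.continuous
      unfold Kernel.dilate
      fun_prop
    have h1 : IntegrableOn (fun y => ‖f y‖ * φ.dilate ε (z - y)) (Metric.closedBall z ε) :=
      IntegrableOn.mul_continuousOn hfB.norm hc (isCompact_closedBall z ε)
    refine (h1.of_forall_sdiff_eq_zero hU fun y hy => ?_)
    rw [hzero y hy.2, mul_zero]
  rw [conv, hf.2 _ hcs (hsupp.trans hz), integral_congr_ae heq, integral_complex_ofReal,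
    ← Complex.ofRealCLM_apply, ← ofReal_norm, Complex.ofRealCLM_apply,
    Complex.norm_of_nonneg (integral_nonneg fun y => mul_nonneg (norm_nonneg _) (hd0 y)),
    ofReal_integral_eq_lintegral_ofReal hint
      (ae_of_all _ fun y => mul_nonneg (norm_nonneg _) (hd0 y))]
  refine lintegral_congr fun y => ?_
  rw [ENNReal.ofReal_mul (norm_nonneg _), ofReal_norm]

/-- If the mean of `f 𝟙_K` over a ball is at least `l`, then the maximal function is at least a
multiple of `l` on a translate of this ball. -/
theorem le_maximalFunction_of_le_lintegral (φ : Kernel d)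
    {T : 𝓢'(EuclideanSpace ℝ (Fin d), ℂ)} {U : Set (EuclideanSpace ℝ (Fin d))}
    (hU : MeasurableSet U) {f : EuclideanSpace ℝ (Fin d) → ℂ} (hf : IsFunctionOn T f U)
    (hpos : ∀ᵐ x ∂(volume.restrict U), 0 ≤ (f x).re ∧ (f x).im = 0)
    {K : Set (EuclideanSpace ℝ (Fin d))} (hKU : K ⊆ U)
    {a : EuclideanSpace ℝ (Fin d)} {r c : ℝ} (hr : 0 < r)
    (hφ : ∀ x ∈ Metric.closedBall a r, c ≤ φ.toFun x)
    {x z : EuclideanSpace ℝ (Fin d)} {ρ : ℝ} (hρ : 0 < ρ)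
    (hz : z ∈ Metric.closedBall (x + (2 * ρ / r) • a) ρ)
    (hzU : Metric.closedBall z (2 * ρ / r) ⊆ U) {l : ℝ≥0∞}
    (hl : l * volume (Metric.closedBall x ρ) ≤
      ∫⁻ y in Metric.closedBall x ρ, ‖K.indicator f y‖ₑ) :
    l * (ENNReal.ofReal (c * (r / 2) ^ d) *
      volume (Metric.ball (0 : EuclideanSpace ℝ (Fin d)) 1)) ≤ maximalFunction φ T z := by
  -- Chosen so that εr = 2ρ: for y within ρ of x and z within ρ of x + εa, the point ε⁻¹(z - y) lies
  -- within r of a, where φ ≥ c.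
  set ε := 2 * ρ / r with hεdef
  have hε : 0 < ε := by positivity
  have hερ : ε * r = 2 * ρ := by rw [hεdef]; field_simp
  have hlow : ∀ y ∈ Metric.closedBall x ρ, c * (ε ^ d)⁻¹ ≤ φ.dilate ε (z - y) := by
    intro y hy
    rw [Kernel.dilate, mul_comm]
    refine mul_le_mul_of_nonneg_left (hφ _ ?_) (by positivity)
    have h1 : ε⁻¹ • (z - y) - a = ε⁻¹ • ((z - (x + ε • a)) + (x - y)) := by
      have : z - (x + ε • a) + (x - y) = (z - y) - ε • a := by abel
      rw [this, smul_sub ε⁻¹ (z - y), smul_smul, inv_mul_cancel₀ hε.ne', one_smul]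
    rw [Metric.mem_closedBall, dist_eq_norm, h1, norm_smul, norm_inv, Real.norm_of_nonneg hε.le,
      inv_mul_le_iff₀ hε, hερ]
    refine (norm_add_le _ _).trans ?_
    rw [Metric.mem_closedBall, dist_eq_norm] at hz
    rw [Metric.mem_closedBall, dist_comm, dist_eq_norm] at hy
    linarith
  calc l * (ENNReal.ofReal (c * (r / 2) ^ d) *
        volume (Metric.ball (0 : EuclideanSpace ℝ (Fin d)) 1))
      = (l * volume (Metric.closedBall x ρ)) * ENNReal.ofReal (c * (ε ^ d)⁻¹) := by
        rw [Measure.addHaar_closedBall _ _ hρ.le, finrank_euclideanSpace_fin]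
        have : c * (r / 2) ^ d = ρ ^ d * (c * (ε ^ d)⁻¹) := by
          have h2 : r / 2 = ρ * ε⁻¹ := by rw [hεdef]; field_simp
          rw [h2, mul_pow, inv_pow]; ring
        rw [this, ENNReal.ofReal_mul (by positivity)]
        ring
    _ ≤ (∫⁻ y in Metric.closedBall x ρ, ‖K.indicator f y‖ₑ) *
          ENNReal.ofReal (c * (ε ^ d)⁻¹) := mul_le_mul_left hl _
    _ = ∫⁻ y in Metric.closedBall x ρ, ‖K.indicator f y‖ₑ * ENNReal.ofReal (c * (ε ^ d)⁻¹) :=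
        (lintegral_mul_const' _ _ ENNReal.ofReal_ne_top).symm
    _ ≤ ∫⁻ y in U, ‖f y‖ₑ * ENNReal.ofReal (φ.dilate ε (z - y)) := by
        rw [← lintegral_indicator Metric.isClosed_closedBall.measurableSet,
          ← lintegral_indicator hU]
        refine lintegral_mono fun y => ?_
        by_cases hy : y ∈ Metric.closedBall x ρ
        · by_cases hyK : y ∈ K
          · rw [Set.indicator_of_mem hy, Set.indicator_of_mem hyK, Set.indicator_of_mem (hKU hyK)]
            gcongr
            exact hlow y hy
          · simp [Set.indicator_of_mem hy, Set.indicator_of_notMem hyK]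
        · simp [Set.indicator_of_notMem hy]
    _ = ‖conv φ T ε hε z‖ₑ := (enorm_conv_eq φ hU hf hpos hε hzU).symm
    _ ≤ maximalFunction φ T z := le_iSup₂ (f := fun ε hε => ‖conv φ T ε hε z‖ₑ) ε hε

/-- The reverse weak-type inequality for the maximal function of a distribution which is a
non-negative function near the compact set `K`. -/
theorem exists_reverse_weak_type (φ : Kernel d) {T : 𝓢'(EuclideanSpace ℝ (Fin d), ℂ)}
    {U : Set (EuclideanSpace ℝ (Fin d))} (hU : IsOpen U)
    {f : EuclideanSpace ℝ (Fin d) → ℂ} (hf : IsFunctionOn T f U)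
    (hpos : ∀ᵐ x ∂(volume.restrict U), 0 ≤ (f x).re ∧ (f x).im = 0)
    {K : Set (EuclideanSpace ℝ (Fin d))} (hK : IsCompact K) (hKU : K ⊆ U)
    (hint : Integrable (K.indicator f)) :
    ∃ C c₁ l₀ R : ℝ, 0 ≤ C ∧ 0 < c₁ ∧ 0 ≤ R ∧ ∀ l, l₀ ≤ l → 0 ≤ l →
      ∃ E : Set (EuclideanSpace ℝ (Fin d)), MeasurableSet E ∧
        (∀ z ∈ E, ‖z‖ ≤ R ∧ ENNReal.ofReal (c₁ * l) ≤ maximalFunction φ T z) ∧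
        ∫⁻ y in {y | ENNReal.ofReal l < ‖K.indicator f y‖ₑ}, ‖K.indicator f y‖ₑ ≤
          ENNReal.ofReal (C * l) * volume E := by
  obtain ⟨a, r, c, hr, hc, hφ⟩ := φ.exists_le_on_closedBall
  obtain ⟨δ, hδ, hδU⟩ := hK.exists_cthickening_subset_open hU hKU
  obtain ⟨R, hR⟩ := (hK.isBounded.cthickening (δ := δ)).subset_closedBall 0
  -- A is the dilation for which the ball of radius As about x contains the translated ball of
  -- radius s. B also accommodates the support radius 2s/r of the rescaled kernel, so s < δ/B keeps
  -- everything in the δ-thickening of K.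
  set A : ℝ := 2 / r * ‖a‖ + 1 with hA
  have hA1 : 1 ≤ A := by
    have : 0 ≤ 2 / r * ‖a‖ := by positivity
    linarith
  set B : ℝ := 2 / r + A with hB
  have hB0 : 0 < B := by positivity
  have hAB : A ≤ B := by
    have : 0 ≤ 2 / r := by positivity
    linarith
  set ρ : ℝ := δ / B with hρ
  have hρ0 : 0 < ρ := by positivity
  set v : ℝ≥0∞ := volume (Metric.closedBall (0 : EuclideanSpace ℝ (Fin d)) ρ) with hv
  have hv0 : v ≠ 0 := (Metric.measure_closedBall_pos volume _ hρ0).ne'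
  have hvt : v ≠ ⊤ := measure_closedBall_lt_top.ne
  have hfin : ∫⁻ y, ‖K.indicator f y‖ₑ ≠ ⊤ := hint.2.ne
  set w : ℝ≥0∞ := volume (Metric.ball (0 : EuclideanSpace ℝ (Fin d)) 1) with hw
  have hw0 : w ≠ 0 := (Metric.measure_ball_pos volume _ one_pos).ne'
  have hwt : w ≠ ⊤ := measure_ball_lt_top.ne
  refine ⟨(5 * A) ^ d, c * (r / 2) ^ d * w.toReal,
    ((∫⁻ y, ‖K.indicator f y‖ₑ) / v).toReal + 1, max R 0, by positivity,
    mul_pos (by positivity) (ENNReal.toReal_pos hw0 hwt), le_max_right _ _, fun l hl hl0 => ?_⟩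
  -- The choice of l₀ forces every ball of mean at least l to have radius below ρ; the added 1 makes
  -- the inequality strict.
  have hlarge : ∫⁻ y, ‖K.indicator f y‖ₑ < ENNReal.ofReal l * v := by
    rw [← ENNReal.div_lt_iff (Or.inl hv0) (Or.inl hvt)]
    rw [ENNReal.lt_ofReal_iff_toReal_lt (ENNReal.div_ne_top hfin hv0)]
    linarith
  obtain ⟨u, s, hcount, hu, hdisj, hle⟩ :=
    exists_disjoint_closedBall_lintegral_le hint.1.enorm hlarge hA1
  have huK : ∀ x ∈ u, x ∈ K := fun x hx => by
    by_contra hxK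
    have := (hu x hx).1
    simp [Set.indicator_of_notMem hxK] at this
  set D : EuclideanSpace ℝ (Fin d) → Set (EuclideanSpace ℝ (Fin d)) :=
    fun x => Metric.closedBall (x + (2 * s x / r) • a) (s x) with hD
  have hdist : ∀ x ∈ u, ∀ z ∈ D x, dist z x ≤ A * s x := by
    intro x hx z hz
    have hs := (hu x hx).2.1
    calc dist z x ≤ dist z (x + (2 * s x / r) • a) + dist (x + (2 * s x / r) • a) x :=
          dist_triangle _ _ _
      _ ≤ s x + 2 * s x / r * ‖a‖ := by
          refine add_le_add hz ?_
          rw [dist_eq_norm, add_sub_cancel_left, norm_smul, Real.norm_of_nonneg (by positivity)]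
      _ = A * s x := by rw [hA]; ring
  have hcth : ∀ x ∈ u, ∀ z ∈ D x, ∀ y ∈ Metric.closedBall z (2 * s x / r),
      y ∈ Metric.cthickening δ K := by
    intro x hx z hz y hy
    have hs := (hu x hx).2.2.1
    refine Metric.mem_cthickening_of_dist_le y x δ K (huK x hx) ?_
    calc dist y x ≤ dist y z + dist z x := dist_triangle _ _ _
      _ ≤ 2 * s x / r + A * s x := add_le_add hy (hdist x hx z hz)
      _ = B * s x := by rw [hB]; ring
      _ ≤ B * ρ := mul_le_mul_of_nonneg_left hs.le hB0.le
      _ = δ := by rw [hρ]; field_simp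
  have := hcount.to_subtype
  refine ⟨⋃ x : u, D x, MeasurableSet.iUnion fun x => Metric.isClosed_closedBall.measurableSet,
    ?_, ?_⟩
  · intro z hz
    obtain ⟨⟨x, hx⟩, hz⟩ := Set.mem_iUnion.1 hz
    obtain ⟨-, hs0, -, hmean⟩ := hu x hx
    constructor
    · have h1 := hR (hcth x hx z hz z (Metric.mem_closedBall_self (by positivity)))
      exact (mem_closedBall_zero_iff.1 h1).trans (le_max_left _ _)
    · have h1 := le_maximalFunction_of_le_lintegral φ hU.measurableSet hf hpos hKU hr hφ hs0 hz
        (fun y hy => hδU (hcth x hx z hz y hy)) hmean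
      refine le_of_eq_of_le ?_ h1
      rw [mul_comm, ENNReal.ofReal_mul hl0, ENNReal.ofReal_mul (by positivity),
        ENNReal.ofReal_toReal hwt]
  · have hDdisj : Pairwise (Function.onFun Disjoint fun x : u => D x) := by
      intro x y hxy
      exact (hdisj x.2 y.2 (fun h => hxy (Subtype.ext h))).mono
        (fun z hz => hdist x x.2 z hz) (fun z hz => hdist y y.2 z hz)
    rw [measure_iUnion hDdisj fun x => Metric.isClosed_closedBall.measurableSet,
      mul_comm ((5 * A) ^ d), ENNReal.ofReal_mul hl0, mul_assoc, ← ENNReal.tsum_mul_left]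
    refine hle.trans (le_of_eq ?_)
    congr 1
    refine tsum_congr fun x => ?_
    have hs0 := (hu x x.2).2.1
    have hA0 : 0 ≤ 5 * A := by linarith
    rw [hD, Measure.addHaar_closedBall _ _ hs0.le, ← mul_assoc 5,
      Measure.addHaar_closedBall _ _ (mul_nonneg hA0 hs0.le),
      finrank_euclideanSpace_fin, ← mul_assoc, mul_pow,
      ENNReal.ofReal_mul (pow_nonneg hA0 d)]

/-! ### Dyadic sums, Ψ and the iterated logarithm -/

theorem sum_two_pow_div_le (N : ℕ) :
    ∑ n ∈ Finset.range (N + 1), (2 : ℝ) ^ n / (n + 1) ≤ 4 * (2 ^ N / (N + 1)) := by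
  induction N with
  | zero => norm_num
  | succ N ih =>
    rw [Finset.sum_range_succ]
    -- The induction step needs 4/(N+1) ≤ 6/(N+2), which fails at N = 0.
    rcases N.eq_zero_or_pos with rfl | hN
    · norm_num [Finset.sum_range_succ]
    · have hN' : (1 : ℝ) ≤ N := by exact_mod_cast hN
      have h2 : (2 : ℝ) ^ N * (4 / (N + 1)) ≤ 2 ^ N * (6 / (N + 1 + 1)) := by
        refine mul_le_mul_of_nonneg_left ?_ (by positivity)
        rw [div_le_div_iff₀ (by positivity) (by positivity)]
        linarith
      have h3 : (2 : ℝ) ^ N * (6 / (N + 1 + 1)) = 3 * (2 ^ (N + 1) / (N + 1 + 1)) := by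
        rw [pow_succ]; ring
      have h4 : (4 : ℝ) * (2 ^ N / (N + 1)) = 2 ^ N * (4 / (N + 1)) := by ring
      push_cast
      linarith

theorem one_le_log_exp_one_add {t : ℝ} (ht : 0 ≤ t) : 1 ≤ Real.log (Real.exp 1 + t) := by
  rw [Real.le_log_iff_exp_le (by positivity)]
  linarith

/-- With L the denominator, s(L(t) - L(s)) ≤ t - s ≤ (t - s)L(s), because log grows slowly and L ≥
1. -/
theorem Psi_mono (x : EuclideanSpace ℝ (Fin d)) {s t : ℝ} (hs : 0 < s) (hst : s ≤ t) :
    Psi x s ≤ Psi x t := by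
  have hx := one_le_log_exp_one_add (norm_nonneg x)
  have h1 := one_le_log_exp_one_add hs.le
  have h2 := one_le_log_exp_one_add (hs.le.trans hst)
  have he := Real.exp_pos 1
  have ht : 0 < t := hs.trans_le hst
  have h3 : Real.log (Real.exp 1 + t) - Real.log (Real.exp 1 + s) ≤ (t - s) / s := by
    rw [← Real.log_div (by positivity) (by positivity)]
    refine (Real.log_le_sub_one_of_pos (by positivity)).trans ?_
    rw [div_sub_one (by positivity)]
    have : Real.exp 1 + t - (Real.exp 1 + s) = t - s := by ring
    rw [this]
    exact div_le_div_of_nonneg_left (by linarith) hs (by linarith)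
  rw [le_div_iff₀ hs] at h3
  rw [Psi, Psi, div_le_div_iff₀ (by linarith) (by linarith)]
  nlinarith [mul_nonneg (sub_nonneg.2 hst) (sub_nonneg.2 h1),
    mul_nonneg (sub_nonneg.2 hst) (sub_nonneg.2 hx)]

/-- Dyadic lower bound for `Ψ`, uniform for `x` in a ball. -/
theorem tsum_two_pow_div_le_Psi {c₁ R : ℝ} (hc₁ : 0 < c₁) (hR : 0 ≤ R) :
    ∃ C : ℝ, 0 ≤ C ∧ ∀ (x : EuclideanSpace ℝ (Fin d)) (t : ℝ) (S : Set ℕ),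
      (∀ n ∈ S, ‖x‖ ≤ R ∧ c₁ * 2 ^ n ≤ t) →
      ∑' n, S.indicator (fun n : ℕ => ENNReal.ofReal (2 ^ n / (n + 1))) n ≤
        ENNReal.ofReal (C * Psi x t) := by
  set D : ℝ := Real.log (Real.exp 1 + c₁) + 1 + Real.log (Real.exp 1 + R) with hD
  have hc1 := one_le_log_exp_one_add hc₁.le
  have hR1 := one_le_log_exp_one_add hR
  have hD0 : 0 < D := by linarith
  refine ⟨4 * (D / c₁), by positivity, fun x t S hS => ?_⟩
  rcases S.eq_empty_or_nonempty with rfl | hne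
  · simp
  obtain ⟨n₁, hn₁⟩ := hne
  have hxR := (hS n₁ hn₁).1
  have hbdd : BddAbove S := by
    obtain ⟨N, hN⟩ := pow_unbounded_of_one_lt (t / c₁) (one_lt_two : (1 : ℝ) < 2)
    refine ⟨N, fun n hn => ?_⟩
    have h1 := (hS n hn).2
    have h2 : (2 : ℝ) ^ n < 2 ^ N := lt_of_le_of_lt ((le_div_iff₀' hc₁).2 h1) hN
    exact ((pow_lt_pow_iff_right₀ one_lt_two).1 h2).le
  set N := sSup S with hN
  have hNS : N ∈ S := Nat.sSup_mem ⟨n₁, hn₁⟩ hbdd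
  have hle : ∀ n ∈ S, n ≤ N := fun n hn => le_csSup hbdd hn
  calc ∑' n, S.indicator (fun n : ℕ => ENNReal.ofReal (2 ^ n / (n + 1))) n
      = ∑ n ∈ Finset.range (N + 1),
          S.indicator (fun n : ℕ => ENNReal.ofReal (2 ^ n / (n + 1))) n := by
        refine tsum_eq_sum fun n hn => Set.indicator_of_notMem (fun h => hn ?_) _
        exact Finset.mem_range.2 (Nat.lt_succ_of_le (hle n h))
    _ ≤ ∑ n ∈ Finset.range (N + 1), ENNReal.ofReal (2 ^ n / (n + 1)) :=
        Finset.sum_le_sum fun n _ => Set.indicator_le_self' (fun _ _ => zero_le) n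
    _ = ENNReal.ofReal (∑ n ∈ Finset.range (N + 1), (2 : ℝ) ^ n / (n + 1)) :=
        (ENNReal.ofReal_sum_of_nonneg fun n _ => by positivity).symm
    _ ≤ ENNReal.ofReal (4 * (D / c₁) * Psi x t) := ENNReal.ofReal_le_ofReal ?_
  refine (sum_two_pow_div_le N).trans ?_
  rw [mul_assoc]
  refine mul_le_mul_of_nonneg_left ?_ (by norm_num)
  have hp : 0 < c₁ * 2 ^ N := by positivity
  refine le_trans ?_ (mul_le_mul_of_nonneg_left (Psi_mono x hp (hS N hNS).2) (by positivity))
  have he := Real.exp_pos 1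
  have hx1 := one_le_log_exp_one_add (norm_nonneg x)
  have hlog : Real.log (Real.exp 1 + c₁ * 2 ^ N) + Real.log (Real.exp 1 + ‖x‖) ≤ D * (N + 1) := by
    have h1 : Real.log (Real.exp 1 + c₁ * 2 ^ N) ≤ Real.log (Real.exp 1 + c₁) + N := by
      have h2 : Real.exp 1 + c₁ * 2 ^ N ≤ (Real.exp 1 + c₁) * 2 ^ N := by
        nlinarith [one_le_pow₀ (one_le_two : (1 : ℝ) ≤ 2) (n := N)]
      refine (Real.log_le_log (by positivity) h2).trans ?_
      rw [Real.log_mul (by positivity) (by positivity), Real.log_pow]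
      have : Real.log 2 ≤ 1 := by linarith [Real.log_two_lt_d9]
      nlinarith [(Nat.cast_nonneg N : (0 : ℝ) ≤ N)]
    have h2 : Real.log (Real.exp 1 + ‖x‖) ≤ Real.log (Real.exp 1 + R) :=
      Real.log_le_log (by positivity) (by linarith)
    have : (0 : ℝ) ≤ N := Nat.cast_nonneg N
    nlinarith
  have hden : 0 < Real.log (Real.exp 1 + c₁ * 2 ^ N) + Real.log (Real.exp 1 + ‖x‖) := by
    linarith [one_le_log_exp_one_add hp.le]
  have heq : (2 : ℝ) ^ N / (N + 1) = D / c₁ * (c₁ * 2 ^ N / (D * (N + 1))) := by field_simp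
  rw [Psi, heq]
  exact mul_le_mul_of_nonneg_left (div_le_div_of_nonneg_left hp.le hden hlog) (by positivity)

/-- If 2^N ≤ t < 2^(N+1), then log t ≤ N + 1, and log(N + 1) is at most the N-th harmonic number.
Its terms with n < n₀ are each at most 1. -/
theorem posLog_posLog_le (n₀ : ℕ) {t : ℝ} (ht : 0 ≤ t) :
    ENNReal.ofReal (log⁺ (log⁺ t)) ≤ n₀ + ∑' n : ℕ,
      {n : ℕ | n₀ ≤ n ∧ 2 ^ n < t}.indicator (fun n : ℕ => ENNReal.ofReal (1 / (n + 1))) n := by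
  rcases le_or_gt t 1 with h1 | h1
  · have : log⁺ t = 0 := (posLog_eq_zero_iff t).2 (by rwa [abs_of_nonneg ht])
    simp [this]
  obtain ⟨N, hN, hN'⟩ := exists_nat_pow_near h1.le (one_lt_two : (1 : ℝ) < 2)
  have hlog0 : 0 ≤ Real.log t := Real.log_nonneg h1.le
  have hlogt : log⁺ t ≤ N + 1 := by
    rw [posLog, max_eq_right hlog0]
    refine (Real.log_le_log (by linarith) hN'.le).trans ?_
    rw [Real.log_pow]
    have : Real.log 2 ≤ 1 := by linarith [Real.log_two_lt_d9]
    push_cast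
    nlinarith [(Nat.cast_nonneg N : (0 : ℝ) ≤ N)]
  have hloglog : log⁺ (log⁺ t) ≤ ∑ n ∈ Finset.range N, (1 / (n + 1) : ℝ) := by
    refine (posLog_le_posLog posLog_nonneg hlogt).trans ?_
    have h2 : log⁺ ((N : ℝ) + 1) = Real.log ((N + 1 : ℕ) : ℝ) := by
      rw [posLog, max_eq_right (Real.log_nonneg (by linarith [(Nat.cast_nonneg N : (0 : ℝ) ≤ N)]))]
      push_cast
      rfl
    rw [h2]
    refine (log_add_one_le_harmonic N).trans (le_of_eq ?_)
    simp [harmonic]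
  calc ENNReal.ofReal (log⁺ (log⁺ t))
      ≤ ENNReal.ofReal (∑ n ∈ Finset.range N, (1 / (n + 1) : ℝ)) := ENNReal.ofReal_le_ofReal hloglog
    _ = ∑ n ∈ Finset.range N, ENNReal.ofReal (1 / (n + 1)) :=
        ENNReal.ofReal_sum_of_nonneg fun n _ => by positivity
    _ ≤ ∑ n ∈ Finset.range N, ((Finset.range n₀ : Set ℕ).indicator (fun _ => 1) n +
          {n : ℕ | n₀ ≤ n ∧ 2 ^ n < t}.indicator
            (fun n : ℕ => ENNReal.ofReal (1 / (n + 1))) n) := by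
        refine Finset.sum_le_sum fun n hn => ?_
        rcases lt_or_ge n n₀ with h | h
        · rw [Set.indicator_of_mem (by simpa using h)]
          refine le_add_right (ENNReal.ofReal_le_one.2 ?_)
          rw [div_le_one (by positivity)]
          linarith [(Nat.cast_nonneg n : (0 : ℝ) ≤ n)]
        · have : (2 : ℝ) ^ n < t :=
            lt_of_lt_of_le (pow_lt_pow_right₀ one_lt_two (Finset.mem_range.1 hn)) hN
          rw [Set.indicator_of_mem (s := {n : ℕ | n₀ ≤ n ∧ 2 ^ n < t}) ⟨h, this⟩]
          exact le_add_self
    _ ≤ _ := by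
        rw [Finset.sum_add_distrib]
        refine add_le_add ((ENNReal.sum_le_tsum _).trans (le_of_eq ?_)) (ENNReal.sum_le_tsum _)
        rw [tsum_eq_sum (s := Finset.range n₀) fun n hn => Set.indicator_of_notMem (by simpa using hn) _,
          Finset.sum_congr rfl fun n hn => Set.indicator_of_mem (Finset.mem_coe.2 hn) _]
        simp

/-! ### Summation over dyadic levels -/

/-- A function `F` satisfying a reverse weak-type inequality against the maximal function of
`T ∈ H^log` is in `L log log L`. -/
theorem lintegral_posLog_posLog_lt_top (φ : Kernel d) {T : 𝓢'(EuclideanSpace ℝ (Fin d), ℂ)}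
    (hT : T ∈ HLog φ) {F : EuclideanSpace ℝ (Fin d) → ℂ} (hF : Integrable F)
    {C c₁ l₀ R : ℝ} (hC : 0 ≤ C) (hc₁ : 0 < c₁) (hR : 0 ≤ R)
    (h : ∀ l, l₀ ≤ l → 0 ≤ l → ∃ E : Set (EuclideanSpace ℝ (Fin d)), MeasurableSet E ∧
        (∀ z ∈ E, ‖z‖ ≤ R ∧ ENNReal.ofReal (c₁ * l) ≤ maximalFunction φ T z) ∧
        ∫⁻ y in {y | ENNReal.ofReal l < ‖F y‖ₑ}, ‖F y‖ₑ ≤ ENNReal.ofReal (C * l) * volume E) :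
    ∫⁻ x, ENNReal.ofReal (‖F x‖ * log⁺ (log⁺ ‖F x‖)) < ⊤ := by
  obtain ⟨n₀, hn₀⟩ := pow_unbounded_of_one_lt l₀ (one_lt_two : (1 : ℝ) < 2)
  have hex : ∀ n : ℕ, ∃ E : Set (EuclideanSpace ℝ (Fin d)), MeasurableSet E ∧
      (∀ z ∈ E, ‖z‖ ≤ R ∧ ENNReal.ofReal (c₁ * 2 ^ n) ≤ maximalFunction φ T z) ∧
      (n₀ ≤ n → ∫⁻ y in {y | ENNReal.ofReal (2 ^ n) < ‖F y‖ₑ}, ‖F y‖ₑ ≤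
        ENNReal.ofReal (C * 2 ^ n) * volume E) := by
    intro n
    by_cases hn : n₀ ≤ n
    · obtain ⟨E, h1, h2, h3⟩ := h (2 ^ n)
        (hn₀.le.trans (pow_le_pow_right₀ one_le_two hn)) (by positivity)
      exact ⟨E, h1, h2, fun _ => h3⟩
    -- Levels below n₀ carry no inequality; the empty set is harmless, as `S n` is empty there too.
    · exact ⟨∅, MeasurableSet.empty, by simp, fun h => absurd h hn⟩
  choose E hEm hE hEle using hex
  obtain ⟨C', hC', hPsi⟩ := tsum_two_pow_div_le_Psi (d := d) hc₁ hR
  set S : ℕ → Set (EuclideanSpace ℝ (Fin d)) :=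
    fun n => {y | n₀ ≤ n ∧ ENNReal.ofReal (2 ^ n) < ‖F y‖ₑ} with hS
  have hSm : ∀ n, NullMeasurableSet (S n) := fun n =>
    (NullMeasurableSet.const _).inter (nullMeasurableSet_lt aemeasurable_const hF.1.enorm)
  have hpoint : ∀ x, ENNReal.ofReal (‖F x‖ * log⁺ (log⁺ ‖F x‖)) ≤
      n₀ * ‖F x‖ₑ +
        ∑' n : ℕ, (S n).indicator (fun y => ENNReal.ofReal (1 / (n + 1)) * ‖F y‖ₑ) x := by
    intro x
    rw [ENNReal.ofReal_mul (norm_nonneg _), ofReal_norm, mul_comm]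
    refine (mul_le_mul_left (posLog_posLog_le n₀ (norm_nonneg (F x))) _).trans (le_of_eq ?_)
    rw [add_mul, ← ENNReal.tsum_mul_right]
    congr 1
    refine tsum_congr fun n => ?_
    by_cases hx : x ∈ S n
    · rw [Set.indicator_of_mem hx, Set.indicator_of_mem]
      refine ⟨hx.1, ?_⟩
      have := hx.2
      rw [← ofReal_norm] at this
      exact ENNReal.ofReal_lt_ofReal_iff'.1 this |>.1
    · rw [Set.indicator_of_notMem hx, Set.indicator_of_notMem, zero_mul]
      rintro ⟨h1, h2⟩
      refine hx ⟨h1, ?_⟩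
      rw [← ofReal_norm]
      exact (ENNReal.ofReal_lt_ofReal_iff (lt_trans (by positivity) h2)).2 h2
  have hterm : ∀ n : ℕ,
      ∫⁻ x, (S n).indicator (fun y => ENNReal.ofReal (1 / (n + 1)) * ‖F y‖ₑ) x ≤
        ENNReal.ofReal C * ∫⁻ x, (E n).indicator (fun _ => ENNReal.ofReal (2 ^ n / (n + 1))) x := by
    intro n
    by_cases hn : n₀ ≤ n
    · have hSn : S n = {y | ENNReal.ofReal (2 ^ n) < ‖F y‖ₑ} := by
        ext y
        simp [hS, hn]
      rw [lintegral_indicator₀ (hSm n), lintegral_const_mul' _ _ ENNReal.ofReal_ne_top,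
        lintegral_indicator (hEm n), setLIntegral_const, hSn]
      refine (mul_le_mul_right (hEle n hn) _).trans (le_of_eq ?_)
      rw [← mul_assoc, ← mul_assoc, ← ENNReal.ofReal_mul (by positivity), ← ENNReal.ofReal_mul hC]
      congr 2
      ring
    · have : S n = ∅ := Set.eq_empty_of_forall_notMem fun y hy => hn hy.1
      simp [this]
  have hsum : ∑' n : ℕ, ∫⁻ x, (E n).indicator (fun _ => ENNReal.ofReal (2 ^ n / (n + 1))) x < ⊤ := by
    rw [← lintegral_tsum fun n => (measurable_const.indicator (hEm n)).aemeasurable]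
    calc ∫⁻ x, ∑' n : ℕ, (E n).indicator (fun _ => ENNReal.ofReal (2 ^ n / (n + 1))) x
        ≤ ∫⁻ x, ENNReal.ofReal C' * ENNReal.ofReal (Psi x (maximalFunction φ T x).toReal) := by
          refine lintegral_mono_ae ?_
          -- Finiteness of M_φ(T)(x) lets the bounds M_φ(T)(x) ≥ c₁ 2^n pass to its real value, so
          -- only finitely many E n contain x.
          filter_upwards [hT.1] with x hx
          rw [← ENNReal.ofReal_mul hC']
          refine le_trans (le_of_eq ?_) (hPsi x _ {n | x ∈ E n} fun n hn => ⟨(hE n x hn).1,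
            (ENNReal.ofReal_le_iff_le_toReal hx.ne).1 (hE n x hn).2⟩)
          exact tsum_congr fun n => rfl
      _ = ENNReal.ofReal C' * ∫⁻ x, ENNReal.ofReal (Psi x (maximalFunction φ T x).toReal) :=
          lintegral_const_mul' _ _ ENNReal.ofReal_ne_top
      _ < ⊤ := ENNReal.mul_lt_top ENNReal.ofReal_lt_top hT.2
  calc ∫⁻ x, ENNReal.ofReal (‖F x‖ * log⁺ (log⁺ ‖F x‖))
      ≤ ∫⁻ x, (n₀ * ‖F x‖ₑ +
        ∑' n : ℕ, (S n).indicator (fun y => ENNReal.ofReal (1 / (n + 1)) * ‖F y‖ₑ) x) :=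
        lintegral_mono hpoint
    _ = n₀ * (∫⁻ x, ‖F x‖ₑ) + ∑' n : ℕ,
          ∫⁻ x, (S n).indicator (fun y => ENNReal.ofReal (1 / (n + 1)) * ‖F y‖ₑ) x := by
        rw [lintegral_add_left' (hF.1.enorm.const_mul _),
          lintegral_const_mul' _ _ (ENNReal.natCast_ne_top n₀),
          lintegral_tsum fun n => (hF.1.enorm.const_mul _).indicator₀ (hSm n)]
    _ ≤ n₀ * (∫⁻ x, ‖F x‖ₑ) + ENNReal.ofReal C *
          ∑' n : ℕ, ∫⁻ x, (E n).indicator (fun _ => ENNReal.ofReal (2 ^ n / (n + 1))) x := by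
        rw [← ENNReal.tsum_mul_left]
        gcongr with n
        exact hterm n
    _ < ⊤ := ENNReal.add_lt_top.2 ⟨ENNReal.mul_lt_top (ENNReal.natCast_lt_top n₀) hF.2,
        ENNReal.mul_lt_top ENNReal.ofReal_lt_top hsum⟩

end HLogSpace

theorem mainTheorem6 (d : ℕ) (φ : HLogSpace.Kernel d)
    (T : 𝓢'(EuclideanSpace ℝ (Fin d), ℂ)) (hT : T ∈ HLogSpace.HLog φ)
    (U : Set (EuclideanSpace ℝ (Fin d))) (hU : IsOpen U)
    (f : EuclideanSpace ℝ (Fin d) → ℂ) (hf : HLogSpace.IsFunctionOn T f U)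
    (hpos : ∀ᵐ x ∂(volume.restrict U), 0 ≤ (f x).re ∧ (f x).im = 0)
    (K : Set (EuclideanSpace ℝ (Fin d))) (hK : IsCompact K) (hKU : K ⊆ U) :
    K.indicator f ∈ HLogSpace.LLogLog K := by
  have hint : Integrable (K.indicator f) :=
    (hf.1.integrableOn_compact_subset hKU hK).integrable_indicator hK.measurableSet
  refine ⟨hint.locallyIntegrable, closure_minimal Set.support_indicator_subset hK.isClosed, ?_⟩
  obtain ⟨C, c₁, l₀, R, hC, hc₁, hR, h⟩ :=
    HLogSpace.exists_reverse_weak_type φ hU hf hpos hK hKU hint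
  exact (setLIntegral_le_lintegral _ _).trans_lt
    (HLogSpace.lintegral_posLog_posLog_lt_top φ hT hint hC hc₁ hR h)
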